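/- Let $\mathcal K$ be a finite set of decorations with $|\mathcal K| = L$. A $\mathcal K$-decorated graphon $W$ is a family of symmetric measurable functions $w^{(l)} : [0,1]^2 \to [0,1]$, $l\in\mathcal K$, with $\sum_l w^{(l)} = 1$; write $W(x,y)=(w^{(l)}(x,y))_l$. For $\alpha\in(0,1]$ let $\mathcal H(\alpha,M)$ be the class of those $W$ with $\|W(x,y)-W(x',y')\|_1\le M\,\|(x,y)-(x',y')\|_1^{\alpha}$ for all $(x,y),(x',y')\in(0,1)^2$. Sampling: $\xi_1,\dots,\xi_n$ are i.i.d. uniform on $[0,1]$; given $\xi$, the decorations $A_{ij}=A_{ji}\in\mathcal K$ ($1\le i\le j\le n$) are independent with $A_{ij}\sim W(\xi_i,\xi_j)$. Put $\theta_{ij}=W(\xi_i,\xi_j)\in[0,1]^L$ and let $X_{ij}\in\{0,1\}^L$ be the indicator vector of $A_{ij}$, i.e. $X_{ij}^{(l)}=1$ if and only if $A_{ij}=l$. Let $\Theta_{s,k}$ be the set of parameter matrices of $(s,k)$-stochastic shape models, that is, of all arrays of the form $\theta_{ij}=Q_{u(g(i),g(j))}$ ($i,j\in[n]$) with a map $g:[n]\to[k]$,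 a symmetric map $u:[k]^2\to[s]$ (so some groups or shapes may be empty) and vectors $Q_c\in[0,1]^L$. The least-squares estimator $\hat\theta$ is a function of $A$ with $\hat\theta\in\operatorname{argmin}_{\theta\in\Theta_{s,k}} n^{-2}\sum_{i,j}\|X_{ij}-\theta_{ij}\|_2^2$, ties being broken arbitrarily. Theorem. Let $M\in\mathbb R$. There is a constant $C_1>0$ depending only on $M$ such that for every $\alpha\in(0,1]$ there is a constant $\beta\ge1$ for which the following holds with $k=\lceil n^{1/(\alpha+1)}\rceil$ and $s=\lceil n^{2\beta^{-1}/(\alpha\wedge1+1)}\rceil$. (1) For every $C'>0$ there is a constant $C>0$, depending only on $C',M,\alpha,\beta$, such that for every finite $\mathcal K$ with $|\mathcal K|=L$, every $n>L$ and every $W\in\mathcal H(\alpha,M)$, $$\frac1{n^2}\sum_{i,j}\|\hat\theta_{ij}-\theta_{ij}\|_2^2\le C\Big(L\,n^{-2\alpha/(\alpha+1)}+\frac{\log n}{n}\Big)$$ with probability at least $1-\exp(-C'n)$. (2) For every finite $\mathcal K$ with $|\mathcal K|=L$ and every $n>L$, $$\sup_{W\in\mathcal H(\alpha,M)}\mathbb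 E\Big[\frac1{n^2}\sum_{i,j}\|\hat\theta_{ij}-\theta_{ij}\|_2^2\Big]\le C_1\Big(L\,n^{-2\alpha/(\alpha+1)}+\frac{\log n}{n}\Big).$$ Probability and expectation are taken jointly over $(A_{ij})$ and $(\xi_i)$. -/

import Mathlib

open MeasureTheory ProbabilityTheory
open scoped ENNReal

/-- A decorated graphon over a finite decoration set `K`: symmetric measurable functions
`w l : [0,1]² → [0,1]`, one for each decoration `l`, which sum to one at every point. The number
`w l x y` is the probability of the decoration `l` under `W(x, y)`. -/
structure DecoratedGraphon (K : Type*) [Fintype K] where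
  w : K → unitInterval → unitInterval → ℝ
  measurable_w : ∀ l, Measurable fun p : unitInterval × unitInterval => w l p.1 p.2
  symm : ∀ l x y, w l x y = w l y x
  nonneg : ∀ l x y, 0 ≤ w l x y
  sum_eq_one : ∀ x y, ∑ l, w l x y = 1

/-- A `K`-decorated graph on `n` nodes: a symmetric array `A : [n] × [n] → K`, stored as a function
of the unordered pair `s(i, j)`. -/
abbrev DecoratedGraph (n : ℕ) (K : Type*) : Type _ := Sym2 (Fin n) → K

namespace DecoratedGraphon

variable {K : Type*} [Fintype K]

/-- `W ∈ ℋ(α, M)`: the graphon is `α`-Hölder with constant `M` on the open unit square, for the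
`ℓ¹` norms on `ℝ^L` and on the plane. -/
def IsHolder (α M : ℝ) (W : DecoratedGraphon K) : Prop :=
  ∀ x ∈ Set.Ioo (0 : unitInterval) 1, ∀ y ∈ Set.Ioo (0 : unitInterval) 1,
  ∀ x' ∈ Set.Ioo (0 : unitInterval) 1, ∀ y' ∈ Set.Ioo (0 : unitInterval) 1,
    ∑ l, |W.w l x y - W.w l x' y'| ≤ M * (|(x : ℝ) - x'| + |(y : ℝ) - y'|) ^ α

/-- The probability matrix `θ_ij = W(ξ_i, ξ_j) ∈ [0,1]^L`, for `i, j ∈ [n]`. -/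
def probs (W : DecoratedGraphon K) {n : ℕ} (ξ : Fin n → unitInterval) :
    Fin n → Fin n → K → ℝ :=
  fun i j l => W.w l (ξ i) (ξ j)

/-- The probability that the unordered pair `e = s(i, j)` gets the decoration `l` when the latent
variables are `ξ`, that is `w l (ξ i) (ξ j)`. -/
def edgeProb (W : DecoratedGraphon K) {n : ℕ} (ξ : Fin n → unitInterval) (e : Sym2 (Fin n))
    (l : K) : ℝ :=
  Sym2.lift ⟨fun i j => W.w l (ξ i) (ξ j), fun i j => W.symm l (ξ i) (ξ j)⟩ e

theorem edgeProb_mk (W : DecoratedGraphon K) {n : ℕ} (ξ : Fin n → unitInterval) (i j : Fin n)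
    (l : K) : W.edgeProb ξ s(i, j) l = W.w l (ξ i) (ξ j) := rfl

theorem edgeProb_nonneg (W : DecoratedGraphon K) {n : ℕ} (ξ : Fin n → unitInterval)
    (e : Sym2 (Fin n)) (l : K) : 0 ≤ W.edgeProb ξ e l := by
  induction e with
  | _ i j => exact W.nonneg l _ _

theorem sum_edgeProb (W : DecoratedGraphon K) {n : ℕ} (ξ : Fin n → unitInterval)
    (e : Sym2 (Fin n)) : ∑ l, W.edgeProb ξ e l = 1 := by
  induction e with
  | _ i j => exact W.sum_eq_one _ _

theorem measurable_edgeProb (W : DecoratedGraphon K) {n : ℕ} (e : Sym2 (Fin n)) (l : K) :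
    Measurable fun ξ : Fin n → unitInterval => W.edgeProb ξ e l := by
  induction e with
  | _ i j =>
    have h : Measurable fun ξ : Fin n → unitInterval => (ξ i, ξ j) :=
      (measurable_pi_apply i).prodMk (measurable_pi_apply j)
    exact (W.measurable_w l).comp h

variable [MeasurableSpace K] [DiscreteMeasurableSpace K]

/-- The law on `K` of the decoration of the pair `e = s(i, j)` given the latent variables: the
distribution `W(ξ_i, ξ_j)`. -/
noncomputable def edgeLaw (W : DecoratedGraphon K) {n : ℕ} (ξ : Fin n → unitInterval)
    (e : Sym2 (Fin n)) : Measure K :=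
  ∑ l, ENNReal.ofReal (W.edgeProb ξ e l) • Measure.dirac l

theorem edgeLaw_singleton (W : DecoratedGraphon K) {n : ℕ} (ξ : Fin n → unitInterval)
    (e : Sym2 (Fin n)) (l : K) : W.edgeLaw ξ e {l} = ENNReal.ofReal (W.edgeProb ξ e l) := by
  classical
  simp [edgeLaw, Measure.finsetSum_apply, Set.indicator_apply]

instance (W : DecoratedGraphon K) {n : ℕ} (ξ : Fin n → unitInterval) (e : Sym2 (Fin n)) :
    IsProbabilityMeasure (W.edgeLaw ξ e) := by
  constructor
  simp only [edgeLaw, Measure.finsetSum_apply, Measure.smul_apply, measure_univ, smul_eq_mul,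
    mul_one]
  rw [← ENNReal.ofReal_sum_of_nonneg (fun l _ => W.edgeProb_nonneg ξ e l), W.sum_edgeProb,
    ENNReal.ofReal_one]

/-- The conditional law of the decorated graph given the latent variables `ξ`: the decorations of
the unordered pairs are independent and `A_ij` has distribution `W(ξ_i, ξ_j)`. -/
noncomputable def graphKernel (W : DecoratedGraphon K) (n : ℕ) :
    Kernel (Fin n → unitInterval) (DecoratedGraph n K) where
  toFun ξ := Measure.pi fun e => W.edgeLaw ξ e
  measurable' := by
    classical
    refine Measure.measurable_of_measurable_coe _ fun S _ => ?_
    have h : ∀ ξ : Fin n → unitInterval, (Measure.pi fun e => W.edgeLaw ξ e) S =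
        ∑ a ∈ S.toFinite.toFinset, ∏ e, ENNReal.ofReal (W.edgeProb ξ e (a e)) := fun ξ => by
      conv_lhs => rw [← S.toFinite.coe_toFinset, ← sum_measure_singleton]
      simp [Measure.pi_singleton, edgeLaw_singleton]
    simp only [h]
    exact Finset.measurable_fun_sum _ fun a _ => Finset.measurable_fun_prod _ fun e _ =>
      (W.measurable_edgeProb e (a e)).ennreal_ofReal

instance (W : DecoratedGraphon K) (n : ℕ) : IsMarkovKernel (W.graphKernel n) :=
  ⟨fun ξ => inferInstanceAs (IsProbabilityMeasure (Measure.pi fun e => W.edgeLaw ξ e))⟩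

/-- The joint law of the latent variables and of the observed graph: `ξ_1, …, ξ_n` are independent
and uniform on `[0,1]`, and given `ξ` the graph is drawn from `graphKernel`. -/
noncomputable def sampleLaw (W : DecoratedGraphon K) (n : ℕ) :
    Measure ((Fin n → unitInterval) × DecoratedGraph n K) :=
  (volume : Measure (Fin n → unitInterval)) ⊗ₘ W.graphKernel n

end DecoratedGraphon

/-- The single-entry binary vectors `X_ij ∈ {0,1}^L`, with `X_ij l = 1` if and only if
`A_ij = l`. -/
def oneHot {n : ℕ} {K : Type*} [DecidableEq K] (A : DecoratedGraph n K) :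
    Fin n → Fin n → K → ℝ :=
  fun i j l => if A s(i, j) = l then 1 else 0

/-- The normalized squared Frobenius distance `n⁻² ∑_ij ‖θ_ij - η_ij‖₂²`. -/
noncomputable def meanSqDist {n : ℕ} {K : Type*} [Fintype K] (θ η : Fin n → Fin n → K → ℝ) : ℝ :=
  (1 / (n : ℝ) ^ 2) * ∑ i, ∑ j, ∑ l, (θ i j l - η i j l) ^ 2

/-- The set `Θ_{s,k}` of the `n × n` parameter matrices of `(s, k)`-stochastic shape models: the
nodes are assigned to `k` groups, the `k × k` blocks are merged symmetrically into shapes labelled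
by `1, …, s`, and `θ_ij` is the constant `Q_c ∈ [0,1]^L` of the shape `c` of the pair `(i, j)`.
Some groups and some shapes may be empty. -/
def shapeModelParams (n s k : ℕ) (K : Type*) : Set (Fin n → Fin n → K → ℝ) :=
  {θ | ∃ (g : Fin n → Fin k) (u : Fin k → Fin k → Fin s) (Q : Fin s → K → ℝ),
    (∀ a b, u a b = u b a) ∧ (∀ c l, Q c l ∈ Set.Icc (0 : ℝ) 1) ∧
      ∀ i j, θ i j = Q (u (g i) (g j))}

/-- `est` is a least-squares estimator over `Θ_{s,k}`: a function of the observed graph `A` whose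
value is always a minimizer of `n⁻² ‖X - θ‖_F²` over `θ ∈ Θ_{s,k}`, ties being broken in any way. -/
def IsLeastSquaresEstimator {n : ℕ} {K : Type*} [Fintype K] [DecidableEq K] (s k : ℕ)
    (est : DecoratedGraph n K → Fin n → Fin n → K → ℝ) : Prop :=
  ∀ A, est A ∈ shapeModelParams n s k K ∧
    IsMinOn (fun θ => meanSqDist (oneHot A) θ) (shapeModelParams n s k K) (est A)

/-- The number of shapes `s = ⌈n^{2β⁻¹/(α ∧ 1 + 1)}⌉`. -/
noncomputable def numShapes (α β : ℝ) (n : ℕ) : ℕ :=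
  ⌈(n : ℝ) ^ (2 * β⁻¹ / (min α 1 + 1))⌉₊

/-- The number of groups `k = ⌈n^{1/(α + 1)}⌉`. -/
noncomputable def numGroups (α : ℝ) (n : ℕ) : ℕ :=
  ⌈(n : ℝ) ^ (1 / (α + 1))⌉₊

/-- The rate `L n^{-2α/(α+1)} + log n / n`. -/
noncomputable def holderRate (L : ℕ) (α : ℝ) (n : ℕ) : ℝ :=
  L * (n : ℝ) ^ (-2 * α / (α + 1)) + Real.log n / n

/-! The witness is β = 1. For n ≥ 16 this allows at least as many shapes as unordered pairs of
groups, so the limit on shapes does not affect the approximation. Evaluating W at midpoints of k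
equal cells gives a shape model θ' with squared bias at most M² k^(-2α) (`exists_shapeModel_near`).

Write ε = X - θ. Comparing the fits of the estimator and of θ' bounds the loss by the bias and the
projection of ε onto a subspace containing the difference of the two. For a fixed assignment g, that
difference lies in a space of dimension at most Lk² + 1, whatever the shapes and their values, so
only the k^n assignments need a union bound. Given ξ, ε is sub-Gaussian (`integral_exp_noise_le`),
and Gaussian averaging makes exp(‖Pε‖²/8) have mean at most √2 per dimension
(`integral_exp_sum_sq_le`). Summing over g gives a positive variable of mean at most m = k^n
2^(Lk²+1), whose logarithm controls the loss.

Since log m is of order n log n + Lk², division by n² gives the rate at k ≈ n^(1/(α+1)). Markov's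
inequality gives the tail bound, and log x ≤ x - 1 the expectation. For n < 16 the trivial bound L
on the loss suffices. -/

/-! ### Exponential moments of squared norms by Gaussian averaging -/

theorem integral_exp_sq_div_four_gaussianReal :
    ∫ x, Real.exp (x ^ 2 / 4) ∂(gaussianReal 0 1) = √2 := by
  have h : ∀ x : ℝ, gaussianPDFReal 0 1 x • Real.exp (x ^ 2 / 4) =
      (√(2 * Real.pi))⁻¹ * Real.exp (-(1 / 4) * x ^ 2) := fun x => by
    rw [gaussianPDFReal, smul_eq_mul, mul_assoc, ← Real.exp_add]
    norm_num
    ring_nf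
    simp
  rw [integral_gaussianReal_eq_integral_smul one_ne_zero, integral_congr_ae (ae_of_all _ h),
    integral_const_mul, integral_gaussian, ← Real.sqrt_inv, ← Real.sqrt_mul (by positivity)]
  congr 1
  field_simp
  norm_num

theorem integrable_exp_sq_div_four_gaussianReal :
    Integrable (fun x : ℝ => Real.exp (x ^ 2 / 4)) (gaussianReal 0 1) := by
  -- A non-integrable function would have integral `0`, not `√2`.
  by_contra h
  have := integral_exp_sq_div_four_gaussianReal
  rw [integral_undef h] at this
  exact (Real.sqrt_pos.2 two_pos).ne this

theorem integral_exp_mul_gaussianReal (x : ℝ) :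
    ∫ t, Real.exp (t / 2 * x) ∂(gaussianReal 0 1) = Real.exp (x ^ 2 / 8) := by
  have h := mgf_gaussianReal (p := gaussianReal 0 1) (X := id) (μ := 0) (v := 1)
    Measure.map_id (x / 2)
  rw [mgf] at h
  convert h using 2
  · ext t; simp only [id]; ring_nf
  · norm_num; ring

/-- If the vector `x` is sub-Gaussian with variance proxy `2`, then the exponential moment of
`‖x‖² / 8` is at most `√2` per coordinate. -/
theorem integral_exp_sum_sq_le {Ω : Type*} [Fintype Ω] [MeasurableSpace Ω]
    [MeasurableSingletonClass Ω] (μ : Measure Ω) [IsFiniteMeasure μ] {ι : Type*} [Fintype ι]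
    (x : ι → Ω → ℝ)
    (h : ∀ t : ι → ℝ, ∫ ω, Real.exp (∑ m, t m * x m ω) ∂μ ≤ Real.exp (∑ m, t m ^ 2)) :
    ∫ ω, Real.exp ((∑ m, x m ω ^ 2) / 8) ∂μ ≤ √2 ^ Fintype.card ι := by
  set γ : Measure (ι → ℝ) := Measure.pi fun _ => gaussianReal 0 1
  have hint : ∀ ω, Integrable (fun t : ι → ℝ => Real.exp (∑ m, t m / 2 * x m ω)) γ := fun ω => by
    simp only [Real.exp_sum]
    refine Integrable.fintype_prod (f := fun m s => Real.exp (s / 2 * x m ω)) fun m => ?_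
    by_contra hc
    have := integral_exp_mul_gaussianReal (x m ω)
    rw [integral_undef hc] at this
    exact (Real.exp_pos _).ne this
  -- Averaging over an independent standard Gaussian t linearizes the square in the exponent, so
  -- that the sub-Gaussian hypothesis applies at t / 2.
  have h1 : ∀ ω, Real.exp ((∑ m, x m ω ^ 2) / 8) =
      ∫ t, Real.exp (∑ m, t m / 2 * x m ω) ∂γ := fun ω => by
    simp only [Real.exp_sum]
    rw [integral_fintype_prod_eq_prod (fun m s => Real.exp (s / 2 * x m ω))]
    simp only [integral_exp_mul_gaussianReal, ← Real.exp_sum, Finset.sum_div]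
  have h2 : ∀ t : ι → ℝ, Real.exp (∑ m, (t m / 2) ^ 2) = ∏ m, Real.exp (t m ^ 2 / 4) := fun t => by
    rw [← Real.exp_sum]
    congr 2
    ext m
    ring
  calc ∫ ω, Real.exp ((∑ m, x m ω ^ 2) / 8) ∂μ
      = ∫ t, ∫ ω, Real.exp (∑ m, t m / 2 * x m ω) ∂μ ∂γ := by
        simp only [h1]
        rw [integral_fintype Integrable.of_finite]
        simp only [integral_fintype (μ := μ) Integrable.of_finite, smul_eq_mul]
        rw [integral_finsetSum _ fun ω _ => (hint ω).const_mul _]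
        simp only [integral_const_mul]
    _ ≤ ∫ t, Real.exp (∑ m, (t m / 2) ^ 2) ∂γ := by
        refine integral_mono ?_ ?_ fun t => h _
        · simp only [integral_fintype (μ := μ) Integrable.of_finite, smul_eq_mul]
          exact integrable_finsetSum _ fun ω _ => (hint ω).const_mul _
        · simp only [h2]
          exact Integrable.fintype_prod (f := fun _ s => Real.exp (s ^ 2 / 4)) fun _ =>
            integrable_exp_sq_div_four_gaussianReal
    _ = √2 ^ Fintype.card ι := by
        simp only [h2]
        rw [integral_fintype_prod_eq_prod (fun _ s => Real.exp (s ^ 2 / 4))]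
        simp [integral_exp_sq_div_four_gaussianReal]

/-! ### Sub-Gaussian noise -/

/-- Hoeffding's lemma on an interval of length 2r, with parameter 1. -/
theorem integral_exp_sub_integral_le {Ω : Type*} [MeasurableSpace Ω] (μ : Measure Ω)
    [IsProbabilityMeasure μ] {X : Ω → ℝ} (hX : Measurable X) {r : ℝ} (hr : 0 ≤ r)
    (hb : ∀ ω, |X ω| ≤ r) :
    ∫ ω, Real.exp (X ω - ∫ ω', X ω' ∂μ) ∂μ ≤ Real.exp (r ^ 2 / 2) := by
  have h := (hasSubgaussianMGF_of_mem_Icc (μ := μ) (a := -r) (b := r) hX.aemeasurable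
    (ae_of_all _ fun ω => abs_le.1 (hb ω))).mgf_le 1
  rw [mgf] at h
  simp only [one_mul] at h
  refine h.trans_eq ?_
  congr 1
  have : ((‖r - -r‖₊ / 2 : NNReal) : ℝ) = r := by
    rw [NNReal.coe_div, coe_nnnorm, Real.norm_eq_abs, abs_of_nonneg (by linarith)]
    simp
  rw [NNReal.coe_pow, this]
  ring

namespace DecoratedGraphon

variable {K : Type*} [Fintype K] [MeasurableSpace K] [DiscreteMeasurableSpace K]

theorem integral_edgeLaw (W : DecoratedGraphon K) {n : ℕ} (ξ : Fin n → unitInterval)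
    (e : Sym2 (Fin n)) (f : K → ℝ) :
    ∫ l, f l ∂(W.edgeLaw ξ e) = ∑ l, W.edgeProb ξ e l * f l := by
  rw [integral_fintype Integrable.of_finite]
  refine Finset.sum_congr rfl fun l _ => ?_
  rw [measureReal_def, edgeLaw_singleton, ENNReal.toReal_ofReal (W.edgeProb_nonneg ξ e l),
    smul_eq_mul]

theorem integral_exp_edge_le (W : DecoratedGraphon K) {n : ℕ} (ξ : Fin n → unitInterval)
    (e : Sym2 (Fin n)) (c : K → ℝ) :
    ∫ l, Real.exp (c l - ∑ l', W.edgeProb ξ e l' * c l') ∂(W.edgeLaw ξ e) ≤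
      Real.exp ((∑ l, c l ^ 2) / 2) := by
  -- The ℓ² norm of c dominates each coordinate, so the variance proxy carries no factor L.
  have h := integral_exp_sub_integral_le (W.edgeLaw ξ e) (X := c) Measurable.of_discrete
    (r := √(∑ l, c l ^ 2)) (Real.sqrt_nonneg _) fun l => Real.abs_le_sqrt
      (Finset.single_le_sum (f := fun l => c l ^ 2) (fun _ _ => sq_nonneg _) (Finset.mem_univ l))
  rwa [integral_edgeLaw W ξ e c, Real.sq_sqrt (Finset.sum_nonneg fun _ _ => sq_nonneg _)] at h

end DecoratedGraphon

/-- Sums over ordered pairs, collected along unordered pairs. -/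
theorem sum_sym2_eq {n : ℕ} {β : Type*} [AddCommMonoid β] (f : Fin n × Fin n → β) :
    ∑ e : Sym2 (Fin n), ∑ p with s(p.1, p.2) = e, f p = ∑ p, f p :=
  Finset.sum_fiberwise _ _ _

/-- At most two ordered pairs lie over an unordered pair, so Cauchy–Schwarz costs a factor 2. -/
theorem sum_sym2_sq_le {n : ℕ} (f : Fin n × Fin n → ℝ) :
    ∑ e : Sym2 (Fin n), (∑ p with s(p.1, p.2) = e, f p) ^ 2 ≤ 2 * ∑ p, f p ^ 2 := by
  rw [← sum_sym2_eq fun p => f p ^ 2, Finset.mul_sum]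
  refine Finset.sum_le_sum fun e _ => sq_sum_le_card_mul_sum_sq.trans ?_
  refine mul_le_mul_of_nonneg_right ?_ (Finset.sum_nonneg fun _ _ => sq_nonneg _)
  induction e with
  | _ a b =>
    have h : (Finset.univ.filter fun p : Fin n × Fin n => s(p.1, p.2) = s(a, b)) ⊆
        {(a, b), (b, a)} := fun p hp => by
      rw [Finset.mem_filter, Sym2.eq_iff] at hp
      simpa [Prod.ext_iff] using hp.2
    exact_mod_cast (Finset.card_le_card h).trans Finset.card_le_two

namespace DecoratedGraphon

variable {K : Type*} [Fintype K] [DecidableEq K] [MeasurableSpace K] [DiscreteMeasurableSpace K]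

/-- Given the latent variables, the noise `X - θ` is sub-Gaussian. -/
theorem integral_exp_noise_le (W : DecoratedGraphon K) {n : ℕ} (ξ : Fin n → unitInterval)
    (v : Fin n × Fin n → K → ℝ) :
    ∫ A, Real.exp (∑ p, ∑ l, v p l * (oneHot A p.1 p.2 l - W.probs ξ p.1 p.2 l))
      ∂(W.graphKernel n ξ) ≤ Real.exp (∑ p, ∑ l, v p l ^ 2) := by
  -- The entries (i, j) and (j, i) share one decoration; independence holds only after their
  -- coefficients are merged.
  set c : Sym2 (Fin n) → K → ℝ := fun e l => ∑ p with s(p.1, p.2) = e, v p l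
  have h1 : ∀ A : DecoratedGraph n K,
      ∑ p, ∑ l, v p l * (oneHot A p.1 p.2 l - W.probs ξ p.1 p.2 l) =
        ∑ e, (c e (A e) - ∑ l, W.edgeProb ξ e l * c e l) := fun A => by
    rw [← sum_sym2_eq]
    refine Finset.sum_congr rfl fun e _ => ?_
    simp only [c, Finset.mul_sum]
    rw [Finset.sum_comm (s := Finset.univ), ← Finset.sum_sub_distrib]
    refine Finset.sum_congr rfl fun p hp => ?_
    obtain rfl := (Finset.mem_filter.1 hp).2
    simp only [oneHot, probs, edgeProb_mk, mul_sub, Finset.sum_sub_distrib]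
    simp [mul_comm]
  simp only [h1, Real.exp_sum]
  change ∫ A, _ ∂(Measure.pi fun e => W.edgeLaw ξ e) ≤ _
  rw [integral_fintype_prod_eq_prod
    (fun e l => Real.exp (c e l - ∑ l', W.edgeProb ξ e l' * c e l'))]
  refine (Finset.prod_le_prod (fun e _ => integral_nonneg fun _ => (Real.exp_pos _).le)
    fun e _ => W.integral_exp_edge_le ξ e (c e)).trans ?_
  rw [← Real.exp_sum, ← Finset.prod_congr rfl fun p _ => Real.exp_sum _ _, ← Real.exp_sum,
    Real.exp_le_exp, ← Finset.sum_div,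
    Finset.sum_comm (s := (Finset.univ : Finset (Sym2 (Fin n)))),
    Finset.sum_comm (s := (Finset.univ : Finset (Fin n × Fin n))), Finset.sum_div]
  refine Finset.sum_le_sum fun l _ => ?_
  -- The factor 2 from merging cancels the 1/2 in Hoeffding's bound.
  linarith [sum_sym2_sq_le fun p => v p l]

end DecoratedGraphon

/-! ### Oracle inequality and projected noise -/

/-- The basic inequality of least squares: if `η` fits `x` at least as well as `θ'` and the noise
`x - θ` acts on `η - θ'` with strength `a`, then `η` is close to `θ`. -/
theorem norm_sub_sq_le_of_fit {E : Type*} [NormedAddCommGroup E] [InnerProductSpace ℝ E]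
    {x θ θ' η : E} {a : ℝ} (hfit : ‖x - η‖ ^ 2 ≤ ‖x - θ'‖ ^ 2)
    (ha : inner ℝ (x - θ) (η - θ') ≤ a * ‖η - θ'‖) (ha0 : 0 ≤ a) :
    ‖η - θ‖ ^ 2 ≤ 4 * ‖θ' - θ‖ ^ 2 + 6 * a ^ 2 := by
  have h1 : x - η = (x - θ) - (η - θ) := by abel
  have h2 : x - θ' = (x - θ) - (θ' - θ) := by abel
  have h3 : η - θ' = (η - θ) - (θ' - θ) := by abel
  have h4 : ‖η - θ'‖ ≤ ‖η - θ‖ + ‖θ' - θ‖ := h3 ▸ norm_sub_le _ _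
  rw [h1, h2, norm_sub_sq_real (x - θ), norm_sub_sq_real (x - θ)] at hfit
  have h6 : inner ℝ (x - θ) (η - θ') = inner ℝ (x - θ) (η - θ) - inner ℝ (x - θ) (θ' - θ) := by
    rw [h3, inner_sub_right]
  have h5 := mul_le_mul_of_nonneg_left h4 ha0
  -- With D = ‖η - θ‖ and d = ‖θ' - θ‖, the fit gives D² ≤ d² + 2a(D + d); then 2aD ≤ D²/2 + 2a² and
  -- 2ad ≤ d² + a².
  nlinarith [sq_nonneg (‖η - θ‖ - 2 * a), sq_nonneg (‖θ' - θ‖ - a)]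

section BlockSpace

variable {n : ℕ} {K : Type*}

/-- An array of vectors as a point of Euclidean space. -/
noncomputable def flattenArray (θ : Fin n → Fin n → K → ℝ) :
    EuclideanSpace ℝ ((Fin n × Fin n) × K) :=
  WithLp.toLp 2 fun q => θ q.1.1 q.1.2 q.2

theorem flattenArray_apply (θ : Fin n → Fin n → K → ℝ) (q : (Fin n × Fin n) × K) :
    flattenArray θ q = θ q.1.1 q.1.2 q.2 := rfl

variable [Fintype K]

theorem norm_flattenArray_sub_sq (θ η : Fin n → Fin n → K → ℝ) :
    ‖flattenArray θ - flattenArray η‖ ^ 2 = ∑ i, ∑ j, ∑ l, (θ i j l - η i j l) ^ 2 := by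
  simp [EuclideanSpace.norm_sq_eq, flattenArray_apply, Fintype.sum_prod_type]

theorem meanSqDist_eq (θ η : Fin n → Fin n → K → ℝ) :
    meanSqDist θ η = 1 / (n : ℝ) ^ 2 * ‖flattenArray θ - flattenArray η‖ ^ 2 := by
  rw [norm_flattenArray_sub_sq, meanSqDist]

/-- The block indicator of a pair of groups and a decoration, for the assignment `g`; and the array
`θ'` itself. -/
noncomputable def blockFamily [DecidableEq K] {k : ℕ} (g : Fin n → Fin k)
    (θ' : Fin n → Fin n → K → ℝ) :
    Option ((Fin k × Fin k) × K) → EuclideanSpace ℝ ((Fin n × Fin n) × K)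
  | none => flattenArray θ'
  | some q => flattenArray fun i j l => if ((g i, g j), l) = q then 1 else 0

/-- The space spanned by `θ'` and by the arrays that are constant on the blocks of `g`. -/
noncomputable def blockSpace [DecidableEq K] {k : ℕ} (g : Fin n → Fin k)
    (θ' : Fin n → Fin n → K → ℝ) : Submodule ℝ (EuclideanSpace ℝ ((Fin n × Fin n) × K)) :=
  Submodule.span ℝ (Set.range (blockFamily g θ'))

theorem finrank_blockSpace_le [DecidableEq K] {k : ℕ} (g : Fin n → Fin k)
    (θ' : Fin n → Fin n → K → ℝ) :
    Module.finrank ℝ (blockSpace g θ') ≤ Fintype.card K * k ^ 2 + 1 := by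
  refine (finrank_range_le_card (R := ℝ) (blockFamily g θ')).trans_eq ?_
  simp only [Fintype.card_option, Fintype.card_prod, Fintype.card_fin]
  ring

/-- The array θ' may come from another assignment than g; including it among the generators costs
one dimension instead of a union over pairs of assignments. -/
theorem sub_mem_blockSpace [DecidableEq K] {k : ℕ} (g : Fin n → Fin k)
    (θ' : Fin n → Fin n → K → ℝ) (R : Fin k → Fin k → K → ℝ) :
    flattenArray (fun i j => R (g i) (g j)) - flattenArray θ' ∈ blockSpace g θ' := by
  refine Submodule.sub_mem _ ?_ (Submodule.subset_span ⟨none, rfl⟩)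
  have h : flattenArray (fun i j => R (g i) (g j)) =
      ∑ q : (Fin k × Fin k) × K, R q.1.1 q.1.2 q.2 • blockFamily g θ' (some q) := by
    ext q
    simp [blockFamily, flattenArray_apply]
  rw [h]
  exact Submodule.sum_mem _ fun q _ =>
    Submodule.smul_mem _ _ (Submodule.subset_span ⟨some q, rfl⟩)

section Noise

variable [DecidableEq K]

/-- The total exponential noise energy over all assignments of the nodes to `k` groups. -/
noncomputable def noiseEnergy (k : ℕ) (θ θ' : Fin n → Fin n → K → ℝ) (A : DecoratedGraph n K) :
    ℝ :=
  ∑ g : Fin n → Fin k, Real.exp (‖(blockSpace g θ').orthogonalProjectionOnto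
    (flattenArray (oneHot A) - flattenArray θ)‖ ^ 2 / 8)

theorem noiseEnergy_pos {k : ℕ} (hk : 0 < k) (θ θ' : Fin n → Fin n → K → ℝ)
    (A : DecoratedGraph n K) : 0 < noiseEnergy k θ θ' A :=
  Finset.sum_pos (fun _ _ => Real.exp_pos _) ⟨fun _ => ⟨0, hk⟩, Finset.mem_univ _⟩

/-- The oracle inequality for the least-squares estimator. -/
theorem IsLeastSquaresEstimator.meanSqDist_le {s k : ℕ}
    {est : DecoratedGraph n K → Fin n → Fin n → K → ℝ} (hest : IsLeastSquaresEstimator s k est)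
    {θ' : Fin n → Fin n → K → ℝ} (hθ' : θ' ∈ shapeModelParams n s k K)
    (θ : Fin n → Fin n → K → ℝ) (hn : 0 < n) (A : DecoratedGraph n K) :
    meanSqDist (est A) θ ≤
      4 * meanSqDist θ' θ + 48 / (n : ℝ) ^ 2 * Real.log (noiseEnergy k θ θ' A) := by
  obtain ⟨⟨g, u, Q, -, -, hQ⟩, hmin⟩ := hest A
  have hfit := hmin hθ'
  have hest' : est A = fun i j => (fun a b => Q (u a b)) (g i) (g j) := funext₂ hQ
  have hmem := sub_mem_blockSpace g θ' fun a b => Q (u a b)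
  rw [← hest'] at hmem
  set U := blockSpace g θ'
  set ε := flattenArray (oneHot A) - flattenArray θ
  have hn2 : (0 : ℝ) < 1 / (n : ℝ) ^ 2 := by positivity
  simp only [Set.mem_ofPred_eq, meanSqDist_eq, mul_le_mul_iff_right₀ hn2] at hfit
  have hinner : inner ℝ ε (flattenArray (est A) - flattenArray θ') ≤
      ‖U.orthogonalProjectionOnto ε‖ * ‖flattenArray (est A) - flattenArray θ'‖ := by
    have := Submodule.inner_orthogonalProjectionOnto_eq_of_mem_right
      (⟨_, hmem⟩ : U) ε
    exact this ▸ real_inner_le_norm _ _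
  have h := norm_sub_sq_le_of_fit hfit hinner (norm_nonneg _)
  -- The assignment chosen by the estimator depends on A, but its term is at most the sum over all
  -- assignments.
  have hlog : ‖U.orthogonalProjectionOnto ε‖ ^ 2 / 8 ≤ Real.log (noiseEnergy k θ θ' A) := by
    rw [Real.le_log_iff_exp_le (noiseEnergy_pos (g ⟨0, hn⟩).pos θ θ' A)]
    exact Finset.single_le_sum (f := fun g => Real.exp
      (‖(blockSpace g θ').orthogonalProjectionOnto ε‖ ^ 2 / 8)) (fun _ _ => (Real.exp_pos _).le)
      (Finset.mem_univ g)
  rw [meanSqDist_eq, meanSqDist_eq]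
  calc _ ≤ 1 / (n : ℝ) ^ 2 * (4 * ‖flattenArray θ' - flattenArray θ‖ ^ 2 +
        48 * Real.log (noiseEnergy k θ θ' A)) :=
        mul_le_mul_of_nonneg_left (h.trans (by linarith)) hn2.le
    _ = _ := by ring

variable [MeasurableSpace K] [DiscreteMeasurableSpace K]

theorem DecoratedGraphon.integral_exp_projection_noise_le (W : DecoratedGraphon K)
    (ξ : Fin n → unitInterval) (U : Submodule ℝ (EuclideanSpace ℝ ((Fin n × Fin n) × K))) :
    ∫ A, Real.exp (‖U.orthogonalProjectionOnto
        (flattenArray (oneHot A) - flattenArray (W.probs ξ))‖ ^ 2 / 8) ∂(W.graphKernel n ξ) ≤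
      √2 ^ Module.finrank ℝ U := by
  set b := stdOrthonormalBasis ℝ U
  have h := integral_exp_sum_sq_le (W.graphKernel n ξ)
    (fun m A => inner ℝ (b m : EuclideanSpace ℝ ((Fin n × Fin n) × K))
      (flattenArray (oneHot A) - flattenArray (W.probs ξ))) fun t => ?_
  · rw [Fintype.card_fin] at h
    refine le_trans (le_of_eq ?_) h
    congr 1
    ext A
    rw [← b.sum_sq_norm_inner_right]
    simp only [Submodule.inner_orthogonalProjectionOnto_eq_of_mem_left, Real.norm_eq_abs, sq_abs]
  -- A combination of the noise coordinates is the inner product of the noise with v, and ‖v‖² = ∑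
  -- t², so the entrywise sub-Gaussian bound transfers to U.
  · set v : U := ∑ m, t m • b m
    have hv : ∑ m, t m ^ 2 = ‖v‖ ^ 2 := by
      rw [← b.sum_sq_norm_inner_right]
      refine Finset.sum_congr rfl fun m _ => ?_
      rw [b.orthonormal.inner_right_fintype, Real.norm_eq_abs, sq_abs]
    have hv' : ‖v‖ ^ 2 = ∑ p : Fin n × Fin n, ∑ l, (v : EuclideanSpace ℝ ((Fin n × Fin n) × K)) (p, l) ^ 2 := by
      rw [← Submodule.norm_coe, EuclideanSpace.norm_sq_eq, Fintype.sum_prod_type]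
      simp
    rw [hv, hv']
    refine le_trans (le_of_eq ?_)
      (W.integral_exp_noise_le ξ fun p l => (v : EuclideanSpace ℝ ((Fin n × Fin n) × K)) (p, l))
    congr 1
    ext A
    congr 1
    simp only [← real_inner_smul_left, ← sum_inner]
    have : ∑ m, t m • (b m : EuclideanSpace ℝ ((Fin n × Fin n) × K)) = v := by simp [v]
    rw [this, PiLp.inner_apply, Fintype.sum_prod_type]
    refine Finset.sum_congr rfl fun p _ => Finset.sum_congr rfl fun l _ => ?_
    simp [flattenArray_apply, mul_comm]

theorem integral_noiseEnergy_le (W : DecoratedGraphon K) (ξ : Fin n → unitInterval) (k : ℕ)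
    (θ' : Fin n → Fin n → K → ℝ) :
    ∫ A, noiseEnergy k (W.probs ξ) θ' A ∂(W.graphKernel n ξ) ≤
      (k : ℝ) ^ n * 2 ^ (Fintype.card K * k ^ 2 + 1) := by
  simp only [noiseEnergy]
  rw [integral_finsetSum _ fun _ _ => Integrable.of_finite]
  have h : ∀ g : Fin n → Fin k, ∫ A, Real.exp (‖(blockSpace g θ').orthogonalProjectionOnto
      (flattenArray (oneHot A) - flattenArray (W.probs ξ))‖ ^ 2 / 8) ∂(W.graphKernel n ξ) ≤
        2 ^ (Fintype.card K * k ^ 2 + 1) := fun g => by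
    refine (W.integral_exp_projection_noise_le ξ _).trans ?_
    refine (pow_le_pow_right₀ (Real.one_le_sqrt.2 one_le_two) (finrank_blockSpace_le g θ')).trans ?_
    exact pow_le_pow_left₀ (Real.sqrt_nonneg _)
      (Real.sqrt_le_left zero_le_two |>.2 (by norm_num)) _
  refine (Finset.sum_le_sum fun g _ => h g).trans_eq ?_
  simp

end Noise

end BlockSpace

/-! ### Approximation of Hölder graphons by shape models -/

/-- The Hölder condition is assumed only on the open square. -/
theorem ae_forall_mem_Ioo (n : ℕ) :
    ∀ᵐ ξ ∂(volume : Measure (Fin n → unitInterval)), ∀ i, ξ i ∈ Set.Ioo (0 : unitInterval) 1 := by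
  rw [ae_all_iff]
  intro i
  have h : ∀ᵐ x : unitInterval, x ∈ Set.Ioo (0 : unitInterval) 1 := by
    filter_upwards [Measure.ae_ne volume (0 : unitInterval), Measure.ae_ne volume (1 : unitInterval)]
      with x h0 h1
    exact ⟨unitInterval.pos_iff_ne_zero.2 h0, unitInterval.lt_one_iff_ne_one.2 h1⟩
  exact (measurePreserving_eval (fun _ : Fin n => (volume : Measure unitInterval)) i).quasiMeasurePreserving.ae h

/-- The midpoint of the `a`-th of `k` cells of equal length. -/
noncomputable def cellMidpoint {k : ℕ} (a : Fin k) : unitInterval :=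
  ⟨(2 * a + 1) / (2 * k), by
    have hk : (0 : ℝ) < k := by exact_mod_cast a.pos
    have ha : (a : ℝ) + 1 ≤ k := by exact_mod_cast a.isLt
    exact ⟨by positivity, (div_le_one (by positivity)).2 (by linarith)⟩⟩

theorem coe_cellMidpoint {k : ℕ} (a : Fin k) :
    (cellMidpoint a : ℝ) = (2 * a + 1) / (2 * k) := rfl

theorem cellMidpoint_mem_Ioo {k : ℕ} (a : Fin k) :
    cellMidpoint a ∈ Set.Ioo (0 : unitInterval) 1 := by
  have hk : (0 : ℝ) < k := by exact_mod_cast a.pos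
  have ha : (a : ℝ) + 1 ≤ k := by exact_mod_cast a.isLt
  refine ⟨?_, ?_⟩
  · rw [← Subtype.coe_lt_coe, coe_cellMidpoint]
    simp only [Set.Icc.coe_zero]
    positivity
  · rw [← Subtype.coe_lt_coe, coe_cellMidpoint, Set.Icc.coe_one, div_lt_one (by positivity)]
    linarith

theorem exists_cellMidpoint_near {k : ℕ} (hk : 0 < k) {x : unitInterval}
    (hx : x ∈ Set.Ioo (0 : unitInterval) 1) :
    ∃ a : Fin k, |(x : ℝ) - cellMidpoint a| ≤ 1 / (2 * k) := by
  have hk' : (0 : ℝ) < k := by exact_mod_cast hk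
  have hx1 : (x : ℝ) < 1 := hx.2
  have h0 : (0 : ℝ) ≤ k * x := mul_nonneg hk'.le x.2.1
  have hlt : ⌊k * (x : ℝ)⌋₊ < k := (Nat.floor_lt h0).2 (by nlinarith)
  refine ⟨⟨⌊k * (x : ℝ)⌋₊, hlt⟩, ?_⟩
  have h1 := Nat.floor_le h0
  have h2 := Nat.lt_floor_add_one (k * (x : ℝ))
  have h3 : (x : ℝ) - cellMidpoint (⟨⌊k * (x : ℝ)⌋₊, hlt⟩ : Fin k) =
      (2 * (k * x) - (2 * ⌊k * (x : ℝ)⌋₊ + 1)) / (2 * k) := by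
    rw [coe_cellMidpoint]
    field_simp
  rw [h3, abs_div, abs_of_pos (by positivity : (0 : ℝ) < 2 * k)]
  exact div_le_div_of_nonneg_right (abs_le.2 ⟨by linarith, by linarith⟩) (by positivity)

section Approximation

variable {K : Type*} [Fintype K]

theorem DecoratedGraphon.edgeProb_le_one (W : DecoratedGraphon K) {n : ℕ}
    (ξ : Fin n → unitInterval) (e : Sym2 (Fin n)) (l : K) : W.edgeProb ξ e l ≤ 1 :=
  W.sum_edgeProb ξ e ▸ Finset.single_le_sum (fun l _ => W.edgeProb_nonneg ξ e l)
    (Finset.mem_univ l)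

theorem meanSqDist_le_of_forall {n : ℕ} (hn : 0 < n) {θ η : Fin n → Fin n → K → ℝ} {c : ℝ}
    (h : ∀ i j, ∑ l, (θ i j l - η i j l) ^ 2 ≤ c) : meanSqDist θ η ≤ c := by
  have hn' : (0 : ℝ) < n := by exact_mod_cast hn
  rw [meanSqDist, one_div_mul_eq_div, div_le_iff₀ (by positivity)]
  refine (Finset.sum_le_sum fun i _ => Finset.sum_le_sum fun j _ => h i j).trans_eq ?_
  simp
  ring

/-- A Hölder graphon is approximated by a shape model, as soon as there are enough shapes for all
the unordered pairs of groups. -/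
theorem DecoratedGraphon.IsHolder.exists_shapeModel_near {α M : ℝ} {W : DecoratedGraphon K}
    (hW : W.IsHolder α M) (hα : 0 < α) {n s k : ℕ} (hn : 0 < n) (hk : 0 < k)
    (hs : (k + 1).choose 2 ≤ s) {ξ : Fin n → unitInterval}
    (hξ : ∀ i, ξ i ∈ Set.Ioo (0 : unitInterval) 1) :
    ∃ θ' ∈ shapeModelParams n s k K,
      meanSqDist θ' (W.probs ξ) ≤ M ^ 2 * (k : ℝ) ^ (-2 * α) := by
  have hk' : (0 : ℝ) < k := by exact_mod_cast hk
  choose g hg using fun i => exists_cellMidpoint_near hk (hξ i)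
  obtain ⟨f⟩ : Nonempty (Sym2 (Fin k) ↪ Fin s) :=
    Function.Embedding.nonempty_of_card_le (by simpa [Sym2.card] using hs)
  -- Unused shapes receive the value 0, which is still admissible in [0,1].
  set Q : Fin s → K → ℝ := Function.extend f (W.edgeProb cellMidpoint) 0
  have hQ : ∀ e, Q (f e) = W.edgeProb cellMidpoint e := fun e => f.injective.extend_apply _ _ _
  refine ⟨fun i j => Q (f s(g i, g j)), ⟨g, fun a b => f s(a, b), Q, fun a b => ?_, fun c l => ?_,
    fun _ _ => rfl⟩, meanSqDist_le_of_forall hn fun i j => ?_⟩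
  · exact congrArg f Sym2.eq_swap
  · by_cases hc : ∃ e, f e = c
    · obtain ⟨e, rfl⟩ := hc
      rw [hQ]
      exact ⟨W.edgeProb_nonneg _ _ _, W.edgeProb_le_one _ _ _⟩
    · simp [Q, Function.extend_apply' _ _ _ hc]
  · simp only [hQ, edgeProb_mk, probs]
    set d : K → ℝ := fun l => W.w l (cellMidpoint (g i)) (cellMidpoint (g j)) -
      W.w l (ξ i) (ξ j)
    -- Each coordinate is off by at most 1 / (2k), so the ℓ¹ distance is at most 1 / k.
    have h1 : ∑ l, |d l| ≤ |M| * (1 / k : ℝ) ^ α := by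
      refine (hW _ (cellMidpoint_mem_Ioo _) _ (cellMidpoint_mem_Ioo _) _ (hξ i) _ (hξ j)).trans ?_
      refine mul_le_mul (le_abs_self M) (Real.rpow_le_rpow (by positivity) ?_ hα.le)
        (by positivity) (abs_nonneg M)
      have hi := hg i
      have hj := hg j
      rw [abs_sub_comm] at hi hj
      refine (add_le_add hi hj).trans_eq ?_
      field_simp
      norm_num
    have h2 : ∑ l, d l ^ 2 ≤ (∑ l, |d l|) ^ 2 := by
      simp only [← sq_abs (d _)]
      exact Finset.sum_sq_le_sq_sum_of_nonneg fun _ _ => abs_nonneg _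
    refine h2.trans ((pow_le_pow_left₀ (Finset.sum_nonneg fun _ _ => abs_nonneg _) h1 2).trans_eq ?_)
    rw [mul_pow, sq_abs, ← Real.rpow_mul_natCast (by positivity), one_div,
      Real.inv_rpow hk'.le, ← Real.rpow_neg hk'.le]
    congr 2
    push_cast
    ring

end Approximation

/-! ### Arithmetic of the rates -/

section Rates

variable {α : ℝ} {n : ℕ}

theorem le_numGroups (α : ℝ) (n : ℕ) : (n : ℝ) ^ (1 / (α + 1)) ≤ numGroups α n := Nat.le_ceil _

theorem numGroups_pos (hn : 0 < n) : 0 < numGroups α n := by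
  have hn' : (0 : ℝ) < n := by exact_mod_cast hn
  exact Nat.ceil_pos.2 (Real.rpow_pos_of_pos hn' _)

theorem numGroups_le (hα : 0 < α) (hn : 0 < n) : numGroups α n ≤ n := by
  have hn' : (1 : ℝ) ≤ n := by exact_mod_cast hn
  refine Nat.ceil_le.2 ((Real.rpow_le_rpow_of_exponent_le hn' ?_).trans_eq (Real.rpow_one _))
  exact (div_le_one (by linarith)).2 (by linarith)

/-- This is the balance behind the choice of k: k² / n² and k^(-2α) have the same order. -/
theorem rpow_inv_sq (hn : 0 < n) (hα : 0 < α) :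
    ((n : ℝ) ^ (1 / (α + 1))) ^ 2 = (n : ℝ) ^ 2 * (n : ℝ) ^ (-2 * α / (α + 1)) := by
  have hn' : (0 : ℝ) < n := by exact_mod_cast hn
  have hα' : α + 1 ≠ 0 := by linarith
  rw [← Real.rpow_natCast, ← Real.rpow_natCast, ← Real.rpow_mul hn'.le, ← Real.rpow_add hn']
  congr 1
  push_cast
  field_simp
  ring

theorem numGroups_sq_le (hα : 0 < α) (hn : 0 < n) :
    (numGroups α n : ℝ) ^ 2 ≤ 4 * ((n : ℝ) ^ 2 * (n : ℝ) ^ (-2 * α / (α + 1))) := by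
  have hn' : (1 : ℝ) ≤ n := by exact_mod_cast hn
  have h1 : 1 ≤ (n : ℝ) ^ (1 / (α + 1)) := Real.one_le_rpow hn' (by positivity)
  have h2 : (numGroups α n : ℝ) < (n : ℝ) ^ (1 / (α + 1)) + 1 :=
    Nat.ceil_lt_add_one (by positivity)
  rw [← rpow_inv_sq hn hα]
  nlinarith [(Nat.cast_nonneg (numGroups α n) : (0 : ℝ) ≤ _)]

theorem numGroups_rpow_le (hα : 0 < α) (hn : 0 < n) :
    (numGroups α n : ℝ) ^ (-2 * α) ≤ (n : ℝ) ^ (-2 * α / (α + 1)) := by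
  have hn' : (0 : ℝ) < n := by exact_mod_cast hn
  refine (Real.rpow_le_rpow_of_nonpos (Real.rpow_pos_of_pos hn' _) (le_numGroups α n)
    (by linarith)).trans_eq ?_
  rw [← Real.rpow_mul hn'.le]
  congr 1
  ring

/-- With x = n^(1/(α+1)), one has k < x + 1 and s ≥ x². The required (x + 2)(x + 1) / 2 ≤ x² holds
for x ≥ 4, which follows from n ≥ 16 and α ≤ 1. -/
theorem choose_numGroups_le_numShapes (hα : 0 < α) (hα1 : α ≤ 1) (hn : 16 ≤ n) :
    (numGroups α n + 1).choose 2 ≤ numShapes α 1 n := by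
  have hn' : (16 : ℝ) ≤ n := by exact_mod_cast hn
  set x := (n : ℝ) ^ (1 / (α + 1)) with hx
  have hx4 : 4 ≤ x := by
    have h : (n : ℝ) ^ (1 / 2 : ℝ) ≤ x :=
      Real.rpow_le_rpow_of_exponent_le (by linarith)
        (one_div_le_one_div_of_le (by linarith) (by linarith))
    rw [← Real.sqrt_eq_rpow] at h
    exact (Real.le_sqrt' (by norm_num)).2 (by linarith) |>.trans h
  have hs : x ^ 2 ≤ numShapes α 1 n := by
    refine le_trans (le_of_eq ?_) (Nat.le_ceil _)
    rw [hx, ← Real.rpow_natCast, ← Real.rpow_mul (by positivity), min_eq_left hα1]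
    congr 1
    push_cast
    ring
  have hk : (numGroups α n : ℝ) < x + 1 := Nat.ceil_lt_add_one (by positivity)
  have h : (((numGroups α n + 1).choose 2 : ℕ) : ℝ) ≤ numShapes α 1 n := by
    rw [Nat.cast_choose_two]
    push_cast
    nlinarith [(Nat.cast_nonneg (numGroups α n) : (0 : ℝ) ≤ _)]
  exact_mod_cast h

theorem card_le_mul_holderRate {L : ℕ} (hα : 0 < α) (hα1 : α ≤ 1) (hn : 0 < n) (hn16 : n < 16) :
    (L : ℝ) ≤ 16 * holderRate L α n := by
  have hn' : (1 : ℝ) ≤ n := by exact_mod_cast hn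
  have hn16' : (n : ℝ) ≤ 16 := by exact_mod_cast hn16.le
  -- For α ≤ 1 the rate exponent is at least -1.
  have h1 : (n : ℝ) ^ (-1 : ℝ) ≤ (n : ℝ) ^ (-2 * α / (α + 1)) := by
    refine Real.rpow_le_rpow_of_exponent_le hn' ?_
    rw [le_div_iff₀ (by linarith)]
    linarith
  have h2 : (1 : ℝ) / 16 ≤ (n : ℝ) ^ (-2 * α / (α + 1)) := by
    refine le_trans ?_ h1
    rw [Real.rpow_neg_one, one_div]
    exact inv_anti₀ (by linarith) hn16'
  have h3 : 0 ≤ Real.log n / n := div_nonneg (Real.log_nonneg hn') (by linarith)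
  have h4 := mul_le_mul_of_nonneg_left h2 (Nat.cast_nonneg L : (0 : ℝ) ≤ L)
  rw [holderRate]
  linarith

theorem log_entropy_le {L : ℕ} (hα : 0 < α) (hn : 0 < n) :
    Real.log ((numGroups α n : ℝ) ^ n * 2 ^ (L * numGroups α n ^ 2 + 1)) ≤
      n * Real.log n + L * (4 * ((n : ℝ) ^ 2 * (n : ℝ) ^ (-2 * α / (α + 1)))) + 1 := by
  have hk : (0 : ℝ) < numGroups α n := by exact_mod_cast numGroups_pos hn
  have hkn : Real.log (numGroups α n) ≤ Real.log n :=
    Real.log_le_log hk (by exact_mod_cast numGroups_le hα hn)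
  have hl : Real.log 2 ≤ 1 := by linarith [Real.log_two_lt_d9]
  rw [Real.log_mul (by positivity) (by positivity), Real.log_pow, Real.log_pow]
  have h1 := mul_le_mul_of_nonneg_left hkn (Nat.cast_nonneg n : (0 : ℝ) ≤ n)
  have h2 := mul_le_mul_of_nonneg_left (numGroups_sq_le hα hn) (Nat.cast_nonneg L : (0 : ℝ) ≤ L)
  have h3 := mul_le_mul_of_nonneg_left hl
    (Nat.cast_nonneg (L * numGroups α n ^ 2 + 1) : (0 : ℝ) ≤ _)
  push_cast at h3 ⊢
  linarith

theorem rate_bound {L : ℕ} (M : ℝ) {c : ℝ} (hc : 0 ≤ c) (hL : 0 < L) (hα : 0 < α)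
    (hn : 16 ≤ n) :
    4 * (M ^ 2 * (n : ℝ) ^ (-2 * α / (α + 1))) + 48 / (n : ℝ) ^ 2 *
      (Real.log ((numGroups α n : ℝ) ^ n * 2 ^ (L * numGroups α n ^ 2 + 1)) + c * n) ≤
        (4 * M ^ 2 + 192 + 96 * c) * holderRate L α n := by
  have hn' : (16 : ℝ) ≤ n := by exact_mod_cast hn
  have hn0 : (0 : ℝ) < n := by linarith
  have hL' : (1 : ℝ) ≤ L := by exact_mod_cast hL
  have hlog : 1 ≤ Real.log n := by
    rw [Real.le_log_iff_exp_le hn0]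
    linarith [Real.exp_one_lt_d9]
  have h1 := log_entropy_le (L := L) hα (by omega : 0 < n)
  set r := (n : ℝ) ^ (-2 * α / (α + 1)) with hr
  have hr0 : 0 < r := Real.rpow_pos_of_pos hn0 _
  set m := Real.log ((numGroups α n : ℝ) ^ n * 2 ^ (L * numGroups α n ^ 2 + 1))
  -- As log n ≥ 1, both the additive 1 and the term c n are absorbed into multiples of n log n.
  have h2 : 48 / (n : ℝ) ^ 2 * (m + c * n) ≤
      48 / (n : ℝ) ^ 2 * (n * Real.log n + L * (4 * (n ^ 2 * r)) + n * Real.log n +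
        c * (n * Real.log n)) := by
    refine mul_le_mul_of_nonneg_left ?_ (by positivity)
    have h3 : (1 : ℝ) ≤ n * Real.log n := by nlinarith
    have h4 : (n : ℝ) ≤ n * Real.log n := by nlinarith
    have h5 := mul_le_mul_of_nonneg_left h4 hc
    linarith
  have h6 : 48 / (n : ℝ) ^ 2 * (n * Real.log n + L * (4 * (n ^ 2 * r)) + n * Real.log n +
      c * (n * Real.log n)) = 192 * (L * r) + (96 + 48 * c) * (Real.log n / n) := by
    field_simp
    ring
  have h7 : r ≤ L * r := by nlinarith
  have h8 : 0 ≤ Real.log n / n := div_nonneg (by linarith) hn0.le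
  have h9 := mul_le_mul_of_nonneg_left h7 (sq_nonneg M)
  have h10 : 0 ≤ c * (L * r) := by positivity
  have h11 : 0 ≤ M ^ 2 * (Real.log n / n) := by positivity
  have h12 : 0 ≤ c * (Real.log n / n) := by positivity
  rw [holderRate, ← hr]
  nlinarith

theorem holderRate_nonneg (L : ℕ) (α : ℝ) (n : ℕ) : 0 ≤ holderRate L α n :=
  add_nonneg (by positivity) (div_nonneg (Real.log_natCast_nonneg n) (Nat.cast_nonneg n))

end Rates

/-! ### Risk bounds -/

namespace DecoratedGraphon

variable {K : Type*} [Fintype K]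

theorem probs_mem_Icc (W : DecoratedGraphon K) {n : ℕ} (ξ : Fin n → unitInterval) (i j : Fin n)
    (l : K) : W.probs ξ i j l ∈ Set.Icc (0 : ℝ) 1 :=
  ⟨W.edgeProb_nonneg ξ s(i, j) l, W.edgeProb_le_one ξ s(i, j) l⟩

theorem nonempty_decorations (W : DecoratedGraphon K) : Nonempty K := by
  by_contra h
  rw [not_nonempty_iff] at h
  simpa using W.sum_eq_one 0 0

end DecoratedGraphon

theorem meanSqDist_nonneg {n : ℕ} {K : Type*} [Fintype K] (θ η : Fin n → Fin n → K → ℝ) :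
    0 ≤ meanSqDist θ η := by
  rw [meanSqDist]
  positivity

theorem measurable_meanSqDist_sample {n : ℕ} {K : Type*} [Fintype K] [MeasurableSpace K]
    [DiscreteMeasurableSpace K] (W : DecoratedGraphon K)
    (est : DecoratedGraph n K → Fin n → Fin n → K → ℝ) :
    Measurable fun ω : (Fin n → unitInterval) × DecoratedGraph n K =>
      meanSqDist (est ω.2) (W.probs ω.1) := by
  refine measurable_from_prod_countable_left fun A => ?_
  simp only [meanSqDist]
  refine (Finset.measurable_fun_sum _ fun i _ => Finset.measurable_fun_sum _ fun j _ =>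
    Finset.measurable_fun_sum _ fun l _ => ?_).const_mul _
  exact ((W.measurable_edgeProb s(i, j) l).const_sub _).pow_const 2

section Risk

variable {K : Type*} [Fintype K] [DecidableEq K] {n : ℕ} {α M : ℝ}
  {est : DecoratedGraph n K → Fin n → Fin n → K → ℝ}

theorem IsLeastSquaresEstimator.meanSqDist_probs_le_card {s k : ℕ}
    (hest : IsLeastSquaresEstimator s k est) (hn : 0 < n) (W : DecoratedGraphon K)
    (ξ : Fin n → unitInterval) (A : DecoratedGraph n K) :
    meanSqDist (est A) (W.probs ξ) ≤ Fintype.card K := by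
  obtain ⟨⟨g, u, Q, -, hQ, hQ'⟩, -⟩ := hest A
  refine meanSqDist_le_of_forall hn fun i j => ?_
  refine (Finset.sum_le_card_nsmul _ _ 1 fun l _ => ?_).trans_eq (by simp)
  have h1 := hQ (u (g i) (g j)) l
  have h2 := W.probs_mem_Icc ξ i j l
  rw [hQ', sq_le_one_iff_abs_le_one, abs_le]
  exact ⟨by linarith [h1.1, h2.2], by linarith [h1.2, h2.1]⟩

variable [MeasurableSpace K] [DiscreteMeasurableSpace K]

/-- The conditional form of the risk bounds: given typical latent variables, the loss exceeds the
approximation error by at most the logarithm of a positive variable of controlled mean. -/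
theorem DecoratedGraphon.IsHolder.exists_loss_le_log {W : DecoratedGraphon K}
    (hW : W.IsHolder α M) (hα : 0 < α) (hα1 : α ≤ 1) (hn : 16 ≤ n)
    (hest : IsLeastSquaresEstimator (numShapes α 1 n) (numGroups α n) est)
    {ξ : Fin n → unitInterval} (hξ : ∀ i, ξ i ∈ Set.Ioo (0 : unitInterval) 1) :
    ∃ F : DecoratedGraph n K → ℝ, (∀ A, 0 < F A) ∧
      ∫ A, F A ∂(W.graphKernel n ξ) ≤
        (numGroups α n : ℝ) ^ n * 2 ^ (Fintype.card K * numGroups α n ^ 2 + 1) ∧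
      ∀ A, meanSqDist (est A) (W.probs ξ) ≤
        4 * (M ^ 2 * (n : ℝ) ^ (-2 * α / (α + 1))) + 48 / (n : ℝ) ^ 2 * Real.log (F A) := by
  have hn0 : 0 < n := by omega
  obtain ⟨θ', hθ', hd⟩ := hW.exists_shapeModel_near hα hn0 (numGroups_pos hn0)
    (choose_numGroups_le_numShapes hα hα1 hn) hξ
  refine ⟨noiseEnergy (numGroups α n) (W.probs ξ) θ', fun A => noiseEnergy_pos (numGroups_pos hn0)
    _ _ A, integral_noiseEnergy_le W ξ _ θ', fun A => ?_⟩
  have h1 := hest.meanSqDist_le hθ' (W.probs ξ) hn0 A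
  have h2 := mul_le_mul_of_nonneg_left (numGroups_rpow_le hα hn0) (sq_nonneg M)
  linarith

theorem DecoratedGraphon.IsHolder.graphKernel_loss_gt_le {W : DecoratedGraphon K}
    (hW : W.IsHolder α M) (hα : 0 < α) (hα1 : α ≤ 1) (hn : 0 < n) {c : ℝ} (hc : 0 ≤ c)
    (hest : IsLeastSquaresEstimator (numShapes α 1 n) (numGroups α n) est)
    {ξ : Fin n → unitInterval} (hξ : ∀ i, ξ i ∈ Set.Ioo (0 : unitInterval) 1) :
    (W.graphKernel n ξ) {A | (4 * M ^ 2 + 192 + 96 * c) * holderRate (Fintype.card K) α n <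
      meanSqDist (est A) (W.probs ξ)} ≤ ENNReal.ofReal (Real.exp (-c * n)) := by
  have := W.nonempty_decorations
  have hrate := holderRate_nonneg (Fintype.card K) α n
  rcases lt_or_ge n 16 with h16 | h16
  · have hempty : {A | (4 * M ^ 2 + 192 + 96 * c) * holderRate (Fintype.card K) α n <
        meanSqDist (est A) (W.probs ξ)} = ∅ := by
      refine Set.eq_empty_of_forall_notMem fun A hA => (Set.mem_ofPred.1 hA).not_ge ?_
      refine (hest.meanSqDist_probs_le_card hn W ξ A).trans
        ((card_le_mul_holderRate hα hα1 hn h16).trans ?_)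
      exact mul_le_mul_of_nonneg_right (by nlinarith [sq_nonneg M]) hrate
    rw [hempty, measure_empty]
    exact zero_le
  obtain ⟨F, hF0, hF, hloss⟩ := hW.exists_loss_le_log hα hα1 h16 hest hξ
  have hbound := rate_bound M hc (Fintype.card_pos (α := K)) hα h16
  have hk : (0 : ℝ) < numGroups α n := by exact_mod_cast numGroups_pos hn
  have hn' : (0 : ℝ) < n := by exact_mod_cast hn
  set m := (numGroups α n : ℝ) ^ n * 2 ^ (Fintype.card K * numGroups α n ^ 2 + 1)
  have hm : 0 < m := by positivity
  -- A loss above the bound forces F to exceed its mean bound m by the factor exp(cn), which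
  -- Markov's inequality controls.
  have hsub : {A | (4 * M ^ 2 + 192 + 96 * c) * holderRate (Fintype.card K) α n <
      meanSqDist (est A) (W.probs ξ)} ⊆ {A | m * Real.exp (c * n) ≤ F A} := by
    intro A hA
    rw [Set.mem_ofPred_eq] at hA ⊢
    have h1 : 48 / (n : ℝ) ^ 2 * (Real.log m + c * n) < 48 / (n : ℝ) ^ 2 * Real.log (F A) := by
      linarith [hloss A]
    have h2 := lt_of_mul_lt_mul_left h1 (by positivity)
    rw [← Real.log_exp (c * n), ← Real.log_mul hm.ne' (Real.exp_pos _).ne'] at h2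
    exact ((Real.log_lt_log_iff (by positivity) (hF0 A)).1 h2).le
  refine (measure_mono hsub).trans ?_
  rw [ENNReal.le_ofReal_iff_toReal_le (measure_ne_top _ _) (Real.exp_pos _).le]
  have hmarkov := mul_meas_ge_le_integral_of_nonneg (μ := W.graphKernel n ξ)
    (ae_of_all _ fun A => (hF0 A).le) Integrable.of_finite (m * Real.exp (c * n))
  have h3 : m * (Real.exp (c * n) * (W.graphKernel n ξ).real {A | m * Real.exp (c * n) ≤ F A}) ≤
      m * 1 := by linarith
  have h4 := le_of_mul_le_mul_left h3 hm
  rw [neg_mul, Real.exp_neg, ← one_div, le_div_iff₀ (Real.exp_pos _), mul_comm]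
  exact h4

theorem DecoratedGraphon.IsHolder.integral_loss_le {W : DecoratedGraphon K}
    (hW : W.IsHolder α M) (hα : 0 < α) (hα1 : α ≤ 1) (hn : 0 < n)
    (hest : IsLeastSquaresEstimator (numShapes α 1 n) (numGroups α n) est)
    {ξ : Fin n → unitInterval} (hξ : ∀ i, ξ i ∈ Set.Ioo (0 : unitInterval) 1) :
    ∫ A, meanSqDist (est A) (W.probs ξ) ∂(W.graphKernel n ξ) ≤
      (4 * M ^ 2 + 192) * holderRate (Fintype.card K) α n := by
  have := W.nonempty_decorations
  have hrate := holderRate_nonneg (Fintype.card K) α n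
  rcases lt_or_ge n 16 with h16 | h16
  · have h1 : ∀ A, meanSqDist (est A) (W.probs ξ) ≤
        (4 * M ^ 2 + 192) * holderRate (Fintype.card K) α n := fun A =>
      (hest.meanSqDist_probs_le_card hn W ξ A).trans
        ((card_le_mul_holderRate hα hα1 hn h16).trans
          (mul_le_mul_of_nonneg_right (by nlinarith [sq_nonneg M]) hrate))
    refine (integral_mono Integrable.of_finite (integrable_const _) h1).trans_eq ?_
    simp
  obtain ⟨F, hF0, hF, hloss⟩ := hW.exists_loss_le_log hα hα1 h16 hest hξ
  have hbound := rate_bound M le_rfl (Fintype.card_pos (α := K)) hα h16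
  have hk : (0 : ℝ) < numGroups α n := by exact_mod_cast numGroups_pos hn
  have hn' : (0 : ℝ) < n := by exact_mod_cast hn
  set m := (numGroups α n : ℝ) ^ n * 2 ^ (Fintype.card K * numGroups α n ^ 2 + 1)
  set b := 4 * (M ^ 2 * (n : ℝ) ^ (-2 * α / (α + 1)))
  have hm : 0 < m := by positivity
  -- The tangent bound log(F/m) ≤ F/m - 1 plays the role of Jensen's inequality; since F has mean at
  -- most m, the -1 cancels after integration.
  have h1 : ∀ A, meanSqDist (est A) (W.probs ξ) ≤
      b + 48 / (n : ℝ) ^ 2 * (Real.log m - 1) + 48 / (n : ℝ) ^ 2 / m * F A := fun A => by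
    have h2 := Real.log_le_sub_one_of_pos (div_pos (hF0 A) hm)
    rw [Real.log_div (hF0 A).ne' hm.ne'] at h2
    have h3 := mul_le_mul_of_nonneg_left h2 (by positivity : 0 ≤ 48 / (n : ℝ) ^ 2)
    have h4 : 48 / (n : ℝ) ^ 2 / m * F A = 48 / (n : ℝ) ^ 2 * (F A / m) := by ring
    linarith [hloss A]
  refine (integral_mono Integrable.of_finite Integrable.of_finite h1).trans ?_
  rw [integral_add (integrable_const _) Integrable.of_finite, integral_const_mul]
  simp only [integral_const, probReal_univ, one_smul]
  have h5 : 48 / (n : ℝ) ^ 2 / m * ∫ A, F A ∂(W.graphKernel n ξ) ≤ 48 / (n : ℝ) ^ 2 := by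
    refine (mul_le_mul_of_nonneg_left hF (by positivity)).trans_eq ?_
    field_simp
  linarith

/-- The high-probability risk bound of the least-squares estimator. -/
theorem DecoratedGraphon.IsHolder.sampleLaw_loss_le {W : DecoratedGraphon K}
    (hW : W.IsHolder α M) (hα : 0 < α) (hα1 : α ≤ 1) (hn : 0 < n) {c : ℝ} (hc : 0 ≤ c)
    (hest : IsLeastSquaresEstimator (numShapes α 1 n) (numGroups α n) est) :
    1 - Real.exp (-c * n) ≤ (W.sampleLaw n).real {ω | meanSqDist (est ω.2) (W.probs ω.1) ≤
      (4 * M ^ 2 + 192 + 96 * c) * holderRate (Fintype.card K) α n} := by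
  have : IsProbabilityMeasure (W.sampleLaw n) := by
    rw [DecoratedGraphon.sampleLaw]
    infer_instance
  have hmeas := measurableSet_le (measurable_meanSqDist_sample W est)
    (measurable_const (a := (4 * M ^ 2 + 192 + 96 * c) * holderRate (Fintype.card K) α n))
  have hcompl : (W.sampleLaw n) {ω | meanSqDist (est ω.2) (W.probs ω.1) ≤
      (4 * M ^ 2 + 192 + 96 * c) * holderRate (Fintype.card K) α n}ᶜ ≤
        ENNReal.ofReal (Real.exp (-c * n)) := by
    rw [DecoratedGraphon.sampleLaw, Measure.compProd_apply hmeas.compl]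
    refine (lintegral_mono_ae (g := fun _ => ENNReal.ofReal (Real.exp (-c * n))) ?_).trans_eq
      (by simp)
    filter_upwards [ae_forall_mem_Ioo n] with ξ hξ
    refine le_trans (measure_mono fun A hA => ?_)
      (hW.graphKernel_loss_gt_le hα hα1 hn hc hest hξ)
    exact Set.mem_ofPred.2 (lt_of_not_ge fun h => hA (Set.mem_ofPred.2 h))
  have h := probReal_compl_eq_one_sub (μ := W.sampleLaw n) hmeas
  have h' := ENNReal.toReal_le_of_le_ofReal (Real.exp_pos _).le hcompl
  rw [← measureReal_def, h] at h'
  linarith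

/-- The bound in expectation of the least-squares estimator. -/
theorem DecoratedGraphon.IsHolder.lintegral_loss_le {W : DecoratedGraphon K}
    (hW : W.IsHolder α M) (hα : 0 < α) (hα1 : α ≤ 1) (hn : 0 < n)
    (hest : IsLeastSquaresEstimator (numShapes α 1 n) (numGroups α n) est) :
    ∫⁻ ω, ENNReal.ofReal (meanSqDist (est ω.2) (W.probs ω.1)) ∂(W.sampleLaw n) ≤
      ENNReal.ofReal ((4 * M ^ 2 + 192) * holderRate (Fintype.card K) α n) := by
  rw [DecoratedGraphon.sampleLaw,
    Measure.lintegral_compProd (measurable_meanSqDist_sample W est).ennreal_ofReal]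
  refine (lintegral_mono_ae (g := fun _ => ENNReal.ofReal ((4 * M ^ 2 + 192) *
    holderRate (Fintype.card K) α n)) ?_).trans_eq (by simp)
  filter_upwards [ae_forall_mem_Ioo n] with ξ hξ
  rw [← ofReal_integral_eq_lintegral_ofReal Integrable.of_finite
    (ae_of_all _ fun A => meanSqDist_nonneg _ _)]
  exact ENNReal.ofReal_le_ofReal (hW.integral_loss_le hα hα1 hn hest hξ)

end Risk

theorem mainTheorem2 (M : ℝ) :
    ∃ C₁ : ℝ, 0 < C₁ ∧ ∀ α : ℝ, 0 < α → α ≤ 1 → ∃ β : ℝ, 1 ≤ β ∧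
      (∀ C' : ℝ, 0 < C' → ∃ C : ℝ, 0 < C ∧
        ∀ (K : Type*) [Fintype K] [DecidableEq K] [MeasurableSpace K] [DiscreteMeasurableSpace K]
          (n : ℕ), Fintype.card K < n →
        ∀ est : DecoratedGraph n K → Fin n → Fin n → K → ℝ,
          IsLeastSquaresEstimator (numShapes α β n) (numGroups α n) est →
        ∀ W : DecoratedGraphon K, W.IsHolder α M →
          1 - Real.exp (-C' * n) ≤
            (W.sampleLaw n).real
              {ω | meanSqDist (est ω.2) (W.probs ω.1) ≤ C * holderRate (Fintype.card K) α n}) ∧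
      (∀ (K : Type*) [Fintype K] [DecidableEq K] [MeasurableSpace K] [DiscreteMeasurableSpace K]
          (n : ℕ), Fintype.card K < n →
        ∀ est : DecoratedGraph n K → Fin n → Fin n → K → ℝ,
          IsLeastSquaresEstimator (numShapes α β n) (numGroups α n) est →
        ⨆ (W : DecoratedGraphon K) (_ : W.IsHolder α M),
            ∫⁻ ω, ENNReal.ofReal (meanSqDist (est ω.2) (W.probs ω.1)) ∂(W.sampleLaw n) ≤
          ENNReal.ofReal (C₁ * holderRate (Fintype.card K) α n)) := by
  -- The expectation constant is the tail constant with c = 0; the tail bound takes c = C'.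
  refine ⟨4 * M ^ 2 + 192, by positivity, fun α hα hα1 => ⟨1, le_rfl, fun C' hC' =>
    ⟨4 * M ^ 2 + 192 + 96 * C', by positivity, ?_⟩, ?_⟩⟩
  · intro K _ _ _ _ n hn est hest W hW
    exact hW.sampleLaw_loss_le hα hα1 (Nat.zero_lt_of_lt hn) hC'.le hest
  · intro K _ _ _ _ n hn est hest
    exact iSup₂_le fun W hW => hW.lintegral_loss_le hα hα1 (Nat.zero_lt_of_lt hn) hest
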